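/- Let $X$ be a random vector in $\mathbb{R}^d$ with mean $\mu = \mathbb{E}[X]$ such that each component of $X$ has a finite absolute third moment, let $X_1, X_2, \dots$ be i.i.d. copies of $X$, and let $\overline{X}_n = \frac1n\sum_{i=1}^n X_i$. Let $N_0 < N_1 < N_2 < \cdots$ be positive integers and let $K$ be a positive integer such that $N_{\ell+1} - N_\ell \le K \le N_0$ for all $\ell \ge 0$. Let $g$ be a concave function on a convex set $D \subseteq \mathbb{R}^d$ such that $\mu$ is an interior point of $D$. Suppose that for each $\ell \ge 0$ we have $\overline{X}_{N_\ell} \in D$ almost surely, and that $N_0 < g(\overline{X}_{N_0})$ almost surely. Put $\mathscr{N} = \{N_1, N_2, \dots\}$ and $$\boldsymbol{N} = \inf\{ n \in \mathscr{N} : n \ge g(\overline{X}_n)\},$$ where $\inf\emptyset = \infty$. Then $g$ is bounded above on $\mathscr{D} = \{\theta \in D : \alpha \le \theta \le \beta\}$ and $$\mathbb{E}[\boldsymbol{N}] \le K + \sup_{\theta \in \mathscr{D}} g(\theta),$$ where $\alpha = \mu - \mathbb{E}[(X-\mu)^+]$ and $\beta = \mu + \mathbb{E}[(X-\mu)^-]$,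 and inequalities, positive parts $x^+=\max(x,0)$, negative parts $x^-=\max(-x,0)$ and expectations of vectors are taken componentwise. (When $g$ attains a maximum on $\mathscr{D}$, the supremum is this maximum.) -/

import Mathlib

open MeasureTheory ProbabilityTheory
open scoped ENNReal

namespace SampleMeanStopping

/-- The sample sum `S_n` of the first `n` observations; the `i`-th observation of the sample
`X_1, X_2, …` is `Xs (i - 1)`. -/
noncomputable def sampleSum {Ω : Type*} {d : ℕ} (Xs : ℕ → Ω → Fin d → ℝ) (n : ℕ) (ω : Ω) :
    Fin d → ℝ :=
  ∑ i ∈ Finset.range n, Xs i ω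

/-- The sample mean `S_n / n`. -/
noncomputable def sampleMean {Ω : Type*} {d : ℕ} (Xs : ℕ → Ω → Fin d → ℝ) (n : ℕ) (ω : Ω) :
    Fin d → ℝ :=
  (n : ℝ)⁻¹ • sampleSum Xs n ω

/-- The set `{N_1, N_2, …}` of sample sizes at which stopping is allowed (`N_0` is left out). -/
def grid (Nseq : ℕ → ℕ) : Set ℕ := {n | ∃ l : ℕ, 1 ≤ l ∧ n = Nseq l}

/-- `inf {n ∈ {N_1, N_2, …} : n ≥ g (S_n / n)}`, with value `∞` if there is no such `n`. -/
noncomputable def stoppingTime {Ω : Type*} {d : ℕ} (Nseq : ℕ → ℕ) (g : (Fin d → ℝ) → ℝ)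
    (Xs : ℕ → Ω → Fin d → ℝ) (ω : Ω) : ℕ∞ :=
  sInf ((fun n : ℕ => (n : ℕ∞)) '' {n | n ∈ grid Nseq ∧ g (sampleMean Xs n ω) ≤ (n : ℝ)})

/-- `α = μ - E[(X - μ)⁺]`, with the positive part and the expectation taken coordinatewise. -/
noncomputable def lowerVec {Ω : Type*} [MeasurableSpace Ω] (P : Measure Ω) {d : ℕ}
    (X : Ω → Fin d → ℝ) : Fin d → ℝ :=
  (∫ ω, X ω ∂P) - ∫ ω, (X ω - ∫ ω', X ω' ∂P)⁺ ∂P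

/-- `β = μ + E[(X - μ)⁻]`, with the negative part and the expectation taken coordinatewise. -/
noncomputable def upperVec {Ω : Type*} [MeasurableSpace Ω] (P : Measure Ω) {d : ℕ}
    (X : Ω → Fin d → ℝ) : Fin d → ℝ :=
  (∫ ω, X ω ∂P) + ∫ ω, (X ω - ∫ ω', X ω' ∂P)⁻ ∂P

/-- The set of all `θ ∈ D` with `α ≤ θ ≤ β` coordinatewise. -/
def feasible {Ω : Type*} [MeasurableSpace Ω] (P : Measure Ω) {d : ℕ}
    (X : Ω → Fin d → ℝ) (D : Set (Fin d → ℝ)) : Set (Fin d → ℝ) :=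
  {θ | θ ∈ D ∧ lowerVec P X ≤ θ ∧ θ ≤ upperVec P X}

end SampleMeanStopping

/-! Let `M` be the last sample size, truncated at index `L`, at which sampling goes on. Then `M < g
(S_M / M)`. Weighting by `M / E M`, Jensen's inequality gives `E M² / E M ≤ g (E S_M / E M)`, and `E
M ≤ E M² / E M` because the variance is nonnegative. The stopping time is at most `M + K` once `L`
is large, so monotone convergence in `L` gives the claim, provided that `E S_M / E M` lies between
`α` and `β`.

This last point (`integral_sum_le`, `weighted_mean_mem_Icc`) needs care, since `M` looks one block
ahead and Wald's identity fails for it. Whether the block after `N_l` is looked at depends only on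
the past; whether it is counted depends on the block itself. Replacing centered terms by their
positive parts allows every block looked at to be counted, after which independence applies. The
surplus is at most one block, of length at most `K ≤ N_0`, and the first `N_0` terms, having mean
zero, pay for it.

Since `g` may be irregular on the boundary of `D`, the argument is run for continuous concave
majorants on the closure of `D`, obtained by shrinking towards `μ` by a factor `s`; finally `s → 1`.
-/

namespace SampleMeanStopping

/-- The `σ`-algebra generated by the first `n` observations. -/
abbrev past {Ω : Type*} {d : ℕ} (Xs : ℕ → Ω → Fin d → ℝ) (n : ℕ) : MeasurableSpace Ω :=
  ⨆ i ∈ Set.Iio n, MeasurableSpace.comap (Xs i) inferInstance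

/-- No stopping at the sample sizes `N_1, …, N_l`, where sampling goes on at `N_k` when the
sample mean lies in `U k`. -/
def contEvent {Ω : Type*} {d : ℕ} (Nseq : ℕ → ℕ) (Xs : ℕ → Ω → Fin d → ℝ)
    (U : ℕ → Set (Fin d → ℝ)) (l : ℕ) : Set Ω :=
  {ω | ∀ k, 1 ≤ k → k ≤ l → sampleMean Xs (Nseq k) ω ∈ U k}

open Classical in
/-- The index, truncated at `L`, of the last sample size at which sampling goes on. -/
noncomputable def lastIdx {Ω : Type*} {d : ℕ} (Nseq : ℕ → ℕ) (Xs : ℕ → Ω → Fin d → ℝ)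
    (U : ℕ → Set (Fin d → ℝ)) (L : ℕ) (ω : Ω) : ℕ :=
  Nat.findGreatest (fun l => ω ∈ contEvent Nseq Xs U l) L

/-! ### Continuation events and the last continuation index -/

section Measurability

variable {Ω : Type*} {d : ℕ} {Nseq : ℕ → ℕ} {Xs : ℕ → Ω → Fin d → ℝ}
  {U : ℕ → Set (Fin d → ℝ)}

theorem past_le [m0 : MeasurableSpace Ω] (hXs : ∀ i, Measurable (Xs i)) (n : ℕ) :
    past Xs n ≤ m0 :=
  iSup₂_le fun i _ => (hXs i).comap_le

theorem measurable_sampleMean_past {n m : ℕ} (h : n ≤ m) :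
    Measurable[past Xs m] (sampleMean Xs n) := by
  let _ : MeasurableSpace Ω := past Xs m
  have hX : ∀ i < n, Measurable (Xs i) := fun i hi => by
    have h1 : MeasurableSpace.comap (Xs i) inferInstance ≤ past Xs m :=
      le_iSup₂_of_le (f := fun i (_ : i ∈ Set.Iio m) =>
        MeasurableSpace.comap (Xs i) inferInstance) i (hi.trans_le h) le_rfl
    exact Measurable.of_comap_le h1
  have : Measurable (sampleSum Xs n) := by
    have : sampleSum Xs n = fun ω => ∑ i ∈ Finset.range n, Xs i ω := rfl
    rw [this]
    exact Finset.measurable_fun_sum _ fun i hi => hX i (Finset.mem_range.1 hi)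
  exact Measurable.const_smul this ((n : ℝ)⁻¹)

theorem measurableSet_contEvent_past (hmono : StrictMono Nseq)
    (hU : ∀ l, MeasurableSet (U l)) (l : ℕ) :
    MeasurableSet[past Xs (Nseq l)] (contEvent Nseq Xs U l) := by
  have : contEvent Nseq Xs U l =
      ⋂ k, ⋂ (_ : 1 ≤ k), ⋂ (_ : k ≤ l), sampleMean Xs (Nseq k) ⁻¹' U k := by
    ext ω; simp [contEvent]
  rw [this]
  refine MeasurableSet.iInter fun k => MeasurableSet.iInter fun _ => MeasurableSet.iInter fun hk => ?_
  exact measurable_sampleMean_past (hmono.monotone hk) (hU k)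

theorem contEvent_zero (ω : Ω) : ω ∈ contEvent Nseq Xs U 0 := fun k h1 h2 => by omega

theorem contEvent_anti {k l : ℕ} (h : k ≤ l) {ω : Ω} (hω : ω ∈ contEvent Nseq Xs U l) :
    ω ∈ contEvent Nseq Xs U k := fun i h1 h2 => hω i h1 (h2.trans h)

theorem lastIdx_le (L : ℕ) (ω : Ω) : lastIdx Nseq Xs U L ω ≤ L := by
  classical
  exact Nat.findGreatest_le _

theorem mem_contEvent_lastIdx (L : ℕ) (ω : Ω) :
    ω ∈ contEvent Nseq Xs U (lastIdx Nseq Xs U L ω) := by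
  classical
  unfold lastIdx
  exact Nat.findGreatest_spec (P := (ω ∈ contEvent Nseq Xs U ·)) (Nat.zero_le L)
    (contEvent_zero ω)

theorem le_lastIdx_iff {k L : ℕ} (h : k ≤ L) (ω : Ω) :
    k ≤ lastIdx Nseq Xs U L ω ↔ ω ∈ contEvent Nseq Xs U k := by
  classical
  exact ⟨fun hk => contEvent_anti hk (mem_contEvent_lastIdx L ω),
    fun hk => Nat.le_findGreatest h hk⟩

theorem lastIdx_mono (ω : Ω) : Monotone fun L => lastIdx Nseq Xs U L ω := fun L L' h => by
  rw [le_lastIdx_iff ((lastIdx_le L ω).trans h)]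
  exact mem_contEvent_lastIdx L ω

theorem measurable_lastIdx [MeasurableSpace Ω] (hXs : ∀ i, Measurable (Xs i))
    (hmono : StrictMono Nseq) (hU : ∀ l, MeasurableSet (U l)) (L : ℕ) :
    Measurable (lastIdx Nseq Xs U L) := by
  classical
  exact measurable_findGreatest fun k _ =>
    past_le hXs _ _ (measurableSet_contEvent_past hmono hU k)

end Measurability

theorem integrable_comp_nat {Ω E : Type*} [MeasurableSpace Ω] {P : Measure Ω}
    [NormedAddCommGroup E] {κ : Ω → ℕ} (hκ : Measurable κ) {L : ℕ} (hL : ∀ ω, κ ω ≤ L)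
    {Z : ℕ → Ω → E} (hZ : ∀ n, Integrable (Z n) P) : Integrable (fun ω => Z (κ ω) ω) P := by
  have : (fun ω => Z (κ ω) ω) =
      fun ω => ∑ k ∈ Finset.range (L + 1), ({ω | κ ω = k} : Set Ω).indicator (Z k) ω := by
    ext ω
    rw [Finset.sum_eq_single (κ ω)]
    · simp
    · intro b _ hb
      exact Set.indicator_of_notMem (fun h => hb h.symm) _
    · intro h
      exact absurd (Finset.mem_range.2 (Nat.lt_succ_of_le (hL ω))) h
  rw [this]
  exact integrable_finsetSum _ fun k _ => (hZ k).indicator (hκ (measurableSet_singleton k))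

/-- An event determined by the first `n` observations is independent of later observations. -/
theorem setIntegral_past {Ω : Type*} [MeasurableSpace Ω] {P : Measure Ω}
    [IsProbabilityMeasure P] {d : ℕ} {Xs : ℕ → Ω → Fin d → ℝ} (hXs : ∀ i, Measurable (Xs i))
    (hindep : iIndepFun Xs P) {n i : ℕ} (hi : n ≤ i) {C : Set Ω}
    (hC : MeasurableSet[past Xs n] C) {φ : (Fin d → ℝ) → ℝ} (hφ : Measurable φ)
    (hint : Integrable (fun ω => φ (Xs i ω)) P) :
    ∫ ω in C, φ (Xs i ω) ∂P = P.real C * ∫ ω, φ (Xs i ω) ∂P := by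
  have hle := past_le hXs n
  have h1 : Indep (⨆ k ∈ ({i} : Set ℕ), MeasurableSpace.comap (Xs k) inferInstance)
      (past Xs n) P :=
    indep_iSup_of_disjoint (fun k => (hXs k).comap_le) hindep
      (Set.disjoint_singleton_left.2 (by simpa using hi))
  rw [iSup_singleton] at h1
  have h2 : StronglyMeasurable[MeasurableSpace.comap (Xs i) inferInstance]
      (fun ω => φ (Xs i ω)) :=
    (hφ.comp (comap_measurable (Xs i))).stronglyMeasurable
  have h3 := condExp_indep_eq (hXs i).comap_le hle h2 h1
  rw [← setIntegral_condExp hle hint hC, setIntegral_congr_ae (g := fun _ => ∫ ω, φ (Xs i ω) ∂P)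
    (hle _ hC) (h3.mono fun ω h _ => h), setIntegral_const, smul_eq_mul]

/-- Turns a value at a random index into a sum over fixed blocks with random indicators. -/
theorem telescope {A : Type*} [AddCommGroup A] (f : ℕ → A) {κ L : ℕ} (h : κ ≤ L) :
    f κ = f 0 + ∑ l ∈ Finset.range L, if l + 1 ≤ κ then f (l + 1) - f l else 0 := by
  rw [← Finset.sum_filter]
  have : (Finset.range L).filter (fun l => l + 1 ≤ κ) = Finset.range κ := by
    ext l; simp; omega
  rw [this, Finset.sum_range_sub]; abel

/-! ### One-sided Wald-type bound -/

section Bounds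

variable {Ω : Type*} [MeasurableSpace Ω] {P : Measure Ω} [IsProbabilityMeasure P] {d : ℕ}
  {Nseq : ℕ → ℕ} {Xs : ℕ → Ω → Fin d → ℝ} {U : ℕ → Set (Fin d → ℝ)}

/-- One-sided bound of the sum of centered terms up to the last sample size at which sampling
goes on. -/
theorem integral_sum_le (X : Ω → Fin d → ℝ) (hXs : ∀ i, Measurable (Xs i))
    (hindep : iIndepFun Xs P) (hident : ∀ i, IdentDistrib (Xs i) X P P)
    (hmono : StrictMono Nseq) {K : ℕ} (hgap : ∀ l, Nseq (l + 1) ≤ Nseq l + K)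
    (hKN0 : K ≤ Nseq 0) (hU : ∀ l, MeasurableSet (U l)) (L : ℕ)
    {φ : (Fin d → ℝ) → ℝ} (hφ : Measurable φ) (hint : Integrable (fun ω => φ (X ω)) P)
    (hzero : ∫ ω, φ (X ω) ∂P = 0) :
    ∫ ω, ∑ i ∈ Finset.range (Nseq (lastIdx Nseq Xs U L ω)), φ (Xs i ω) ∂P ≤
      (∫ ω, (Nseq (lastIdx Nseq Xs U L ω) : ℝ) ∂P) * ∫ ω, (φ (X ω))⁺ ∂P := by
  have hκ := measurable_lastIdx (U := U) hXs hmono hU L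
  have hφp : Measurable fun x => (φ x)⁺ := hφ.max measurable_const
  have hid : ∀ i, IdentDistrib (fun ω => φ (Xs i ω)) (fun ω => φ (X ω)) P P :=
    fun i => (hident i).comp hφ
  have hidp : ∀ i, IdentDistrib (fun ω => (φ (Xs i ω))⁺) (fun ω => (φ (X ω))⁺) P P :=
    fun i => (hident i).comp hφp
  have hi : ∀ i, Integrable (fun ω => φ (Xs i ω)) P := fun i => (hid i).integrable_iff.2 hint
  have hip : ∀ i, Integrable (fun ω => (φ (Xs i ω))⁺) P :=
    fun i => (hidp i).integrable_iff.2 hint.pos_part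
  set e := ∫ ω, (φ (X ω))⁺ ∂P with he
  have he0 : 0 ≤ e := integral_nonneg fun ω => posPart_nonneg _
  have hC := fun l => past_le hXs _ _ (measurableSet_contEvent_past (Xs := Xs) hmono hU l)
  set C := contEvent Nseq Xs U with hCdef
  have hle : ∀ l, Nseq l ≤ Nseq (l + 1) := fun l => hmono.monotone (Nat.le_succ l)
  -- Block `l` is counted on `C (l + 1)`, which depends on the block. Positive parts allow passing
  -- to the larger event `C l`, which is independent of it.
  set B : ℕ → Ω → ℝ := fun l ω => ∑ i ∈ Finset.Ico (Nseq l) (Nseq (l + 1)), (φ (Xs i ω))⁺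
  have hB : ∀ l, Integrable (B l) P := fun l => integrable_finsetSum _ fun i _ => hip i
  have hpt : ∀ ω, ∑ i ∈ Finset.range (Nseq (lastIdx Nseq Xs U L ω)), φ (Xs i ω) ≤
      (∑ i ∈ Finset.range (Nseq 0), φ (Xs i ω)) +
        ∑ l ∈ Finset.range L, (C l).indicator (B l) ω := by
    intro ω
    rw [telescope (fun k => ∑ i ∈ Finset.range (Nseq k), φ (Xs i ω)) (lastIdx_le L ω)]
    refine add_le_add_right (Finset.sum_le_sum fun l hl => ?_) _
    have hBn : 0 ≤ B l ω := Finset.sum_nonneg fun i _ => posPart_nonneg _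
    split_ifs with h
    · rw [le_lastIdx_iff (Nat.succ_le_of_lt (Finset.mem_range.1 hl))] at h
      rw [Set.indicator_of_mem (contEvent_anti (Nat.le_succ l) h),
        ← Finset.sum_Ico_eq_sub _ (hle l)]
      exact Finset.sum_le_sum fun i _ => le_posPart _
    · exact Set.indicator_nonneg (fun _ _ => Finset.sum_nonneg fun i _ => posPart_nonneg _) _
  have hBC : ∀ l, ∫ ω, (C l).indicator (B l) ω ∂P =
      (∫ ω, (C l).indicator (fun _ => ((Nseq (l + 1) : ℝ) - Nseq l)) ω ∂P) * e := by
    intro l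
    rw [integral_indicator (hC l), integral_indicator (hC l), setIntegral_const,
      integral_finsetSum _ fun i _ => (hip i).integrableOn]
    rw [Finset.sum_congr rfl (g := fun _ => P.real (C l) * e)]
    · rw [Finset.sum_const, Nat.card_Ico, nsmul_eq_mul, Nat.cast_sub (hle l), smul_eq_mul]; ring
    · intro i hi'
      rw [setIntegral_past hXs hindep (Finset.mem_Ico.1 hi').1
        (measurableSet_contEvent_past hmono hU l) hφp (hip i), (hidp i).integral_eq]
  have hs0 : ∫ ω, ∑ i ∈ Finset.range (Nseq 0), φ (Xs i ω) ∂P = 0 := by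
    rw [integral_finsetSum _ fun i _ => hi i]
    exact Finset.sum_eq_zero fun i _ => (hid i).integral_eq.trans hzero
  have hI : ∀ l, Integrable ((C l).indicator (fun _ => ((Nseq (l + 1) : ℝ) - Nseq l))) P :=
    fun l => (integrable_const _).indicator (hC l)
  calc
    _ ≤ ∫ ω, ((∑ i ∈ Finset.range (Nseq 0), φ (Xs i ω)) +
        ∑ l ∈ Finset.range L, (C l).indicator (B l) ω) ∂P :=
      integral_mono
        (integrable_comp_nat hκ (fun ω => lastIdx_le L ω)
          (Z := fun k ω => ∑ i ∈ Finset.range (Nseq k), φ (Xs i ω))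
          fun k => integrable_finsetSum _ fun i _ => hi i)
        ((integrable_finsetSum _ fun i _ => hi i).add
          (integrable_finsetSum _ fun l _ => (hB l).indicator (hC l))) hpt
    _ = (∫ ω, ∑ l ∈ Finset.range L,
          (C l).indicator (fun _ => ((Nseq (l + 1) : ℝ) - Nseq l)) ω ∂P) * e := by
      rw [integral_add (integrable_finsetSum _ fun i _ => hi i)
        (integrable_finsetSum _ fun l _ => (hB l).indicator (hC l)), hs0, zero_add,
        integral_finsetSum _ fun l _ => (hB l).indicator (hC l),
        integral_finsetSum _ fun l _ => hI l, Finset.sum_mul]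
      exact Finset.sum_congr rfl fun l _ => hBC l
    _ ≤ _ := by
      refine mul_le_mul_of_nonneg_right (integral_mono (integrable_finsetSum _ fun l _ => hI l)
        (integrable_comp_nat hκ (fun ω => lastIdx_le L ω)
          (Z := fun k _ => (Nseq k : ℝ)) fun k => integrable_const _) fun ω => ?_) he0
      set κ := lastIdx Nseq Xs U L ω with hκd
      -- The lengths of the blocks looked at add up to `N_{min (κ + 1) L} - N_0`, which is at most
      -- `N_κ + K - N_0 ≤ N_κ`.
      have h1 := telescope (fun k => (Nseq k : ℝ)) (min_le_right (κ + 1) L)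
      have h2 : ∑ l ∈ Finset.range L,
            (C l).indicator (fun _ => ((Nseq (l + 1) : ℝ) - Nseq l)) ω =
          ∑ l ∈ Finset.range L, if l + 1 ≤ min (κ + 1) L then
            (Nseq (l + 1) : ℝ) - Nseq l else 0 := by
        refine Finset.sum_congr rfl fun l hl => ?_
        have hl := Finset.mem_range.1 hl
        have h3 : l + 1 ≤ min (κ + 1) L ↔ ω ∈ C l := by
          rw [← le_lastIdx_iff hl.le]; omega
        by_cases h : ω ∈ C l
        · rw [Set.indicator_of_mem h, if_pos (h3.2 h)]
        · rw [Set.indicator_of_notMem h, if_neg fun h' => h (h3.1 h')]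
      have h4 : Nseq (min (κ + 1) L) ≤ Nseq κ + K :=
        (hmono.monotone (min_le_left _ _)).trans (hgap κ)
      have h5 : (Nseq (min (κ + 1) L) : ℝ) ≤ Nseq κ + Nseq 0 := by
        exact_mod_cast h4.trans (by omega)
      beta_reduce
      rw [h2]
      linarith

end Bounds

/-! ### Weighted Jensen inequality and location of the weighted mean -/

/-- The weighted mean of points of a closed convex set lies in this set. -/
theorem weighted_integral_mem {Ω F : Type*} [MeasurableSpace Ω] {P : Measure Ω}
    [NormedAddCommGroup F] [NormedSpace ℝ F] [CompleteSpace F]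
    {H : Set F} (hH : Convex ℝ H) (hHc : IsClosed H) {w : Ω → NNReal} (hw : Measurable w)
    (hw0 : ∀ ω, w ω ≠ 0) (hwi : Integrable (fun ω => (w ω : ℝ)) P)
    (hpos : 0 < ∫ ω, (w ω : ℝ) ∂P) {Z : Ω → F} (hZ : Integrable Z P)
    (hmem : ∀ᵐ ω ∂P, (w ω)⁻¹ • Z ω ∈ H) :
    (∫ ω, (w ω : ℝ) ∂P)⁻¹ • ∫ ω, Z ω ∂P ∈ H := by
  -- Under the measure with density `w`, the weighted mean is an ordinary average.
  set Q := P.withDensity fun ω => (w ω : ℝ≥0∞) with hQ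
  have hfin : IsFiniteMeasure Q := isFiniteMeasure_withDensity (by
    have := hwi.lintegral_lt_top
    simpa using this.ne)
  have h1 : Q.real Set.univ = ∫ ω, (w ω : ℝ) ∂P := by
    have h := integral_withDensity_eq_integral_smul (μ := P) hw (fun _ => (1 : ℝ))
    rw [← hQ, integral_const, smul_eq_mul, mul_one] at h
    rw [h]
    simp [NNReal.smul_def]
  have hne : NeZero Q := ⟨fun h => by
    rw [h] at h1
    simp at h1
    linarith⟩
  have hcancel : ∀ ω, w ω • ((w ω)⁻¹ • Z ω) = Z ω := fun ω => smul_inv_smul₀ (hw0 ω) _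
  have hi : Integrable (fun ω => (w ω)⁻¹ • Z ω) Q := by
    rw [integrable_withDensity_iff_integrable_smul hw]
    simpa only [hcancel] using hZ
  have h2 := hH.average_mem hHc ((withDensity_absolutelyContinuous P _).ae_le hmem) hi
  rw [average_eq, h1, integral_withDensity_eq_integral_smul hw] at h2
  simpa only [hcancel] using h2

variable {Ω : Type*} [MeasurableSpace Ω] {P : Measure Ω} [IsProbabilityMeasure P] {d : ℕ}
  {Nseq : ℕ → ℕ} {Xs : ℕ → Ω → Fin d → ℝ}

theorem lowerVec_apply {X : Ω → Fin d → ℝ} (hX : Integrable X P) (j : Fin d) :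
    lowerVec P X j =
      (∫ ω, X ω j ∂P) - ∫ ω, (X ω j - ∫ ω', X ω' j ∂P)⁺ ∂P := by
  have hXj : ∀ i, Integrable (fun ω => X ω i) P := hX.eval
  have h1 : ∀ i, (∫ ω, X ω ∂P) i = ∫ ω, X ω i ∂P := eval_integral hXj
  have h2 : (∫ ω, (X ω - ∫ ω', X ω' ∂P)⁺ ∂P) j = ∫ ω, (X ω j - ∫ ω', X ω' j ∂P)⁺ ∂P := by
    rw [eval_integral]
    · simp only [Pi.posPart_apply, Pi.sub_apply, h1]
    · intro i
      simp only [Pi.posPart_apply, Pi.sub_apply, h1]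
      exact ((hXj i).sub (integrable_const _)).pos_part
  rw [lowerVec, Pi.sub_apply, h2, h1]

theorem upperVec_apply {X : Ω → Fin d → ℝ} (hX : Integrable X P) (j : Fin d) :
    upperVec P X j =
      (∫ ω, X ω j ∂P) + ∫ ω, (X ω j - ∫ ω', X ω' j ∂P)⁻ ∂P := by
  have hXj : ∀ i, Integrable (fun ω => X ω i) P := hX.eval
  have h1 : ∀ i, (∫ ω, X ω ∂P) i = ∫ ω, X ω i ∂P := eval_integral hXj
  have h2 : (∫ ω, (X ω - ∫ ω', X ω' ∂P)⁻ ∂P) j = ∫ ω, (X ω j - ∫ ω', X ω' j ∂P)⁻ ∂P := by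
    rw [eval_integral]
    · simp only [Pi.negPart_apply, Pi.sub_apply, h1]
    · intro i
      simp only [Pi.negPart_apply, Pi.sub_apply, h1]
      exact ((hXj i).sub (integrable_const _)).neg_part
  rw [upperVec, Pi.add_apply, h2, h1]

/-- The weighted mean of the sample mean at the last sample size at which sampling goes on lies
between `lowerVec` and `upperVec`. -/
theorem weighted_mean_mem_Icc {X : Ω → Fin d → ℝ} (hX : Integrable X P)
    (hXs : ∀ i, Measurable (Xs i))
    (hindep : iIndepFun Xs P) (hident : ∀ i, IdentDistrib (Xs i) X P P)
    (hmono : StrictMono Nseq) {K : ℕ} (hgap : ∀ l, Nseq (l + 1) ≤ Nseq l + K)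
    (hKN0 : K ≤ Nseq 0) {U : ℕ → Set (Fin d → ℝ)} (hU : ∀ l, MeasurableSet (U l)) (L : ℕ)
    (hpos : 0 < ∫ ω, (Nseq (lastIdx Nseq Xs U L ω) : ℝ) ∂P) :
    (∫ ω, (Nseq (lastIdx Nseq Xs U L ω) : ℝ) ∂P)⁻¹ •
      ∫ ω, sampleSum Xs (Nseq (lastIdx Nseq Xs U L ω)) ω ∂P ∈
        Set.Icc (lowerVec P X) (upperVec P X) := by
  have hκ := measurable_lastIdx (U := U) hXs hmono hU L
  have hκL := fun ω => lastIdx_le (Nseq := Nseq) (Xs := Xs) (U := U) L ω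
  set κ := lastIdx Nseq Xs U L
  set m := ∫ ω, (Nseq (κ ω) : ℝ) ∂P with hm
  have hMi : Integrable (fun ω => (Nseq (κ ω) : ℝ)) P :=
    integrable_comp_nat hκ hκL (Z := fun k _ => (Nseq k : ℝ)) fun k => integrable_const _
  have hXi : ∀ i, Integrable (Xs i) P := fun i => (hident i).integrable_iff.2 hX
  have hSi : Integrable (fun ω => sampleSum Xs (Nseq (κ ω)) ω) P :=
    integrable_comp_nat hκ hκL (Z := fun k ω => sampleSum Xs (Nseq k) ω)
      fun k => integrable_finsetSum _ fun i _ => hXi i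
  have key : ∀ j, lowerVec P X j ≤ m⁻¹ * ∫ ω, sampleSum Xs (Nseq (κ ω)) ω j ∂P ∧
      m⁻¹ * ∫ ω, sampleSum Xs (Nseq (κ ω)) ω j ∂P ≤ upperVec P X j := by
    intro j
    have hXj : Integrable (fun ω => X ω j) P := hX.eval j
    rw [lowerVec_apply hX, upperVec_apply hX]
    set c := ∫ ω, X ω j ∂P with hc
    have hYi : Integrable (fun ω => X ω j - c) P := hXj.sub (integrable_const _)
    have hzero : ∫ ω, (X ω j - c) ∂P = 0 := by
      rw [integral_sub hXj (integrable_const _), integral_const, probReal_univ, one_smul, ← hc,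
        sub_self]
    -- The upper bound comes out with the positive part and the lower one with the negative part;
    -- centering makes the two expectations equal, so they can be exchanged.
    have hpn : ∫ ω, (X ω j - c)⁺ ∂P = ∫ ω, (X ω j - c)⁻ ∂P := by
      have h1 : ∫ ω, ((X ω j - c)⁺ - (X ω j - c)⁻) ∂P =
          ∫ ω, (X ω j - c)⁺ ∂P - ∫ ω, (X ω j - c)⁻ ∂P :=
        integral_sub hYi.pos_part hYi.neg_part
      simp only [posPart_sub_negPart, hzero] at h1
      linarith
    have hup := integral_sum_le X hXs hindep hident hmono hgap hKN0 hU L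
      (φ := fun x => x j - c) (by fun_prop) hYi hzero
    have hlo := integral_sum_le X hXs hindep hident hmono hgap hKN0 hU L
      (φ := fun x => -(x j - c)) (by fun_prop) hYi.neg
      (by rw [integral_neg, hzero, neg_zero])
    have hsum : ∫ ω, ∑ i ∈ Finset.range (Nseq (κ ω)), (Xs i ω j - c) ∂P =
        (∫ ω, sampleSum Xs (Nseq (κ ω)) ω j ∂P) - m * c := by
      rw [hm, ← integral_mul_const, ← integral_sub (hSi.eval j) (hMi.mul_const c)]
      congr 1
      ext ω
      simp [sampleSum, Finset.sum_apply, Finset.sum_sub_distrib]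
    simp only [posPart_neg, Finset.sum_neg_distrib, integral_neg] at hlo
    change -∫ ω, ∑ i ∈ Finset.range (Nseq (κ ω)), (Xs i ω j - c) ∂P ≤
      m * ∫ ω, (X ω j - c)⁻ ∂P at hlo
    change ∫ ω, ∑ i ∈ Finset.range (Nseq (κ ω)), (Xs i ω j - c) ∂P ≤
      m * ∫ ω, (X ω j - c)⁺ ∂P at hup
    rw [hsum] at hlo hup
    rw [inv_mul_eq_div, le_div_iff₀ hpos, div_le_iff₀ hpos, hpn]
    rw [hpn] at hup
    constructor <;> linarith
  have hev : ∀ j, (m⁻¹ • ∫ ω, sampleSum Xs (Nseq (κ ω)) ω ∂P) j =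
      m⁻¹ * ∫ ω, sampleSum Xs (Nseq (κ ω)) ω j ∂P := fun j => by
    rw [Pi.smul_apply, smul_eq_mul, eval_integral fun i => hSi.eval i]
  exact ⟨fun j => (hev j).symm ▸ (key j).1, fun j => (hev j).symm ▸ (key j).2⟩

/-! ### Bounds for a continuous concave function on a closed set -/

/-- The region in which sampling goes on at sample size `n`. -/
def contRegion (E : Set (Fin d → ℝ)) (h : (Fin d → ℝ) → ℝ) (n : ℕ) : Set (Fin d → ℝ) :=
  {x | x ∈ E ∧ (n : ℝ) < h x}

theorem measurableSet_contRegion {E : Set (Fin d → ℝ)} (hE : IsClosed E)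
    {h : (Fin d → ℝ) → ℝ} (hc : ContinuousOn h E) (n : ℕ) :
    MeasurableSet (contRegion E h n) := by
  have : contRegion E h n = E \ (E ∩ h ⁻¹' Set.Iic (n : ℝ)) := by
    ext x
    simp only [contRegion, Set.mem_ofPred_eq, Set.mem_sdiff, Set.mem_inter_iff, Set.mem_preimage,
      Set.mem_Iic, not_and, not_le]
    tauto
  rw [this]
  exact hE.measurableSet.diff (hc.preimage_isClosed_of_isClosed hE isClosed_Iic).measurableSet

/-- Bound of the mean of the last sample size at which sampling goes on. -/
theorem integral_lastIdx_le {X : Ω → Fin d → ℝ} (hX : Integrable X P)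
    (hXs : ∀ i, Measurable (Xs i))
    (hindep : iIndepFun Xs P) (hident : ∀ i, IdentDistrib (Xs i) X P P)
    (hmono : StrictMono Nseq) (hN0 : 0 < Nseq 0) {K : ℕ}
    (hgap : ∀ l, Nseq (l + 1) ≤ Nseq l + K) (hKN0 : K ≤ Nseq 0)
    {E : Set (Fin d → ℝ)} (hE : IsClosed E) {h : (Fin d → ℝ) → ℝ}
    (hh : ConcaveOn ℝ E h) (hc : ContinuousOn h E)
    (hstart : ∀ᵐ ω ∂P, sampleMean Xs (Nseq 0) ω ∈ contRegion E h (Nseq 0))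
    {b : ℝ} (hb : ∀ θ ∈ E, θ ∈ Set.Icc (lowerVec P X) (upperVec P X) → h θ ≤ b) (L : ℕ) :
    ∫ ω, (Nseq (lastIdx Nseq Xs (fun l => contRegion E h (Nseq l)) L ω) : ℝ) ∂P ≤ b := by
  set U : ℕ → Set (Fin d → ℝ) := fun l => contRegion E h (Nseq l)
  have hU : ∀ l, MeasurableSet (U l) := fun l => measurableSet_contRegion hE hc _
  have hκ := measurable_lastIdx (U := U) hXs hmono hU L
  have hκL := fun ω => lastIdx_le (Nseq := Nseq) (Xs := Xs) (U := U) L ω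
  have hbox := weighted_mean_mem_Icc hX hXs hindep hident hmono hgap hKN0 hU L
  have hspec := fun ω => mem_contEvent_lastIdx (Nseq := Nseq) (Xs := Xs) (U := U) L ω
  set κ := lastIdx Nseq Xs U L
  have hMpos : ∀ ω, 0 < Nseq (κ ω) := fun ω => hN0.trans_le (hmono.monotone (Nat.zero_le _))
  have hMi : Integrable (fun ω => (Nseq (κ ω) : ℝ)) P :=
    integrable_comp_nat hκ hκL (Z := fun k _ => (Nseq k : ℝ)) fun k => integrable_const _
  have hM2i : Integrable (fun ω => (Nseq (κ ω) : ℝ) ^ 2) P :=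
    integrable_comp_nat hκ hκL (Z := fun k _ => (Nseq k : ℝ) ^ 2) fun k => integrable_const _
  have hXi : ∀ i, Integrable (Xs i) P := fun i => (hident i).integrable_iff.2 hX
  have hSi : Integrable (fun ω => sampleSum Xs (Nseq (κ ω)) ω) P :=
    integrable_comp_nat hκ hκL (Z := fun k ω => sampleSum Xs (Nseq k) ω)
      fun k => integrable_finsetSum _ fun i _ => hXi i
  have hpos : 0 < ∫ ω, (Nseq (κ ω) : ℝ) ∂P := by
    have h1 : ∫ _, (1 : ℝ) ∂P ≤ ∫ ω, (Nseq (κ ω) : ℝ) ∂P :=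
      integral_mono (integrable_const _) hMi fun ω => by
        exact Nat.one_le_cast.2 (hMpos ω)
    rw [integral_const, probReal_univ, one_smul] at h1
    linarith
  -- Jensen's inequality is applied as a mean in the closed convex hypograph: the points `(S_M / M,
  -- M)` lie in it, and weight `M` turns them into `(S_M, M²)`.
  have hcl : IsClosed {p : (Fin d → ℝ) × ℝ | p.1 ∈ E ∧ p.2 ≤ h p.1} :=
    (upperSemicontinuousOn_iff_isClosed_hypograph hE).1 hc.upperSemicontinuousOn
  have hmem := weighted_integral_mem (P := P) hh.convex_hypograph hcl
    (w := fun ω => (Nseq (κ ω) : NNReal))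
    ((measurable_from_nat (f := fun k => (Nseq k : NNReal))).comp hκ)
    (fun ω => by exact_mod_cast (hMpos ω).ne') (by simpa using hMi) (by simpa using hpos)
    (Z := fun ω => (sampleSum Xs (Nseq (κ ω)) ω, (Nseq (κ ω) : ℝ) ^ 2)) (hSi.prodMk hM2i) (by
      filter_upwards [hstart] with ω hω
      have h1 : sampleMean Xs (Nseq (κ ω)) ω ∈ contRegion E h (Nseq (κ ω)) := by
        rcases Nat.eq_zero_or_pos (κ ω) with h0 | h0
        · rw [h0]; exact hω
        · exact hspec ω _ h0 le_rfl
      have hne : (Nseq (κ ω) : ℝ) ≠ 0 := by exact_mod_cast (hMpos ω).ne'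
      refine ⟨?_, ?_⟩
      · simpa [NNReal.smul_def, sampleMean] using h1.1
      · have : (Nseq (κ ω) : ℝ)⁻¹ * (Nseq (κ ω) : ℝ) ^ 2 = Nseq (κ ω) := by field_simp
        simpa [NNReal.smul_def, sampleMean, this] using h1.2.le)
  rw [integral_pair hSi hM2i] at hmem
  simp only [NNReal.coe_natCast, Prod.smul_mk, Set.mem_ofPred_eq, smul_eq_mul] at hmem
  have hfin := hmem.2.trans (hb _ hmem.1 (hbox hpos))
  set m := ∫ ω, (Nseq (κ ω) : ℝ) ∂P with hm
  have hsq : 0 ≤ (∫ ω, (Nseq (κ ω) : ℝ) ^ 2 ∂P) - m ^ 2 := by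
    have h1 : 0 ≤ ∫ ω, ((Nseq (κ ω) : ℝ) - m) ^ 2 ∂P := integral_nonneg fun ω => sq_nonneg _
    have h2 : ∫ ω, ((Nseq (κ ω) : ℝ) - m) ^ 2 ∂P =
        ∫ ω, ((Nseq (κ ω) : ℝ) ^ 2 - 2 * m * Nseq (κ ω) + m ^ 2) ∂P :=
      integral_congr_ae (Filter.Eventually.of_forall fun ω => by ring)
    have h3 : Integrable (fun ω => (Nseq (κ ω) : ℝ) ^ 2 - 2 * m * Nseq (κ ω)) P :=
      hM2i.sub (hMi.const_mul _)
    rw [h2, integral_add h3 (integrable_const _),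
      integral_sub hM2i (hMi.const_mul _), integral_const_mul, integral_const, probReal_univ,
      one_smul, ← hm] at h1
    linarith
  refine le_trans ?_ hfin
  rw [inv_mul_eq_div, le_div_iff₀ hpos]
  linarith

theorem stoppingTime_le {Ω : Type*} {Xs : ℕ → Ω → Fin d → ℝ} {g : (Fin d → ℝ) → ℝ} {l : ℕ} (hl : 1 ≤ l) {ω : Ω}
    (h : g (sampleMean Xs (Nseq l) ω) ≤ Nseq l) :
    stoppingTime Nseq g Xs ω ≤ (Nseq l : ℕ∞) :=
  sInf_le ⟨Nseq l, ⟨⟨l, hl, rfl⟩, h⟩, rfl⟩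

/-- The stopping time of a function `g` is bounded by that of a continuous concave majorant. -/
theorem lintegral_stoppingTime_le {X : Ω → Fin d → ℝ} (hX : Integrable X P)
    (hXs : ∀ i, Measurable (Xs i))
    (hindep : iIndepFun Xs P) (hident : ∀ i, IdentDistrib (Xs i) X P P)
    (hmono : StrictMono Nseq) (hN0 : 0 < Nseq 0) {K : ℕ}
    (hgap : ∀ l, Nseq (l + 1) ≤ Nseq l + K) (hKN0 : K ≤ Nseq 0)
    {D E : Set (Fin d → ℝ)} (hDE : D ⊆ E) (hE : IsClosed E) {g h : (Fin d → ℝ) → ℝ}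
    (hgh : ∀ x ∈ D, g x ≤ h x) (hh : ConcaveOn ℝ E h) (hc : ContinuousOn h E)
    (hrange : ∀ l, ∀ᵐ ω ∂P, sampleMean Xs (Nseq l) ω ∈ D)
    (hstart : ∀ᵐ ω ∂P, (Nseq 0 : ℝ) < g (sampleMean Xs (Nseq 0) ω))
    {b : ℝ} (hb : ∀ θ ∈ E, θ ∈ Set.Icc (lowerVec P X) (upperVec P X) → h θ ≤ b) :
    ∫⁻ ω, (stoppingTime Nseq g Xs ω : ℝ≥0∞) ∂P ≤ ENNReal.ofReal (K + b) := by
  have hbound := integral_lastIdx_le hX hXs hindep hident hmono hN0 hgap hKN0 hE hh hc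
    (by filter_upwards [hrange 0, hstart] with ω h1 h2 using ⟨hDE h1, h2.trans_le (hgh _ h1)⟩) hb
  set U : ℕ → Set (Fin d → ℝ) := fun l => contRegion E h (Nseq l)
  have hU : ∀ l, MeasurableSet (U l) := fun l => measurableSet_contRegion hE hc _
  have hκ := measurable_lastIdx (U := U) hXs hmono hU
  have hle : ∀ᵐ ω ∂P, (stoppingTime Nseq g Xs ω : ℝ≥0∞) ≤
      ⨆ L, ((Nseq (lastIdx Nseq Xs U L ω) + K : ℕ) : ℝ≥0∞) := by
    filter_upwards [ae_all_iff.2 hrange] with ω hω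
    by_cases hall : ∀ l, ω ∈ contEvent Nseq Xs U l
    -- If sampling never ends, the last index is `L` for each truncation `L`, and `N_L ≥ L`.
    · have : (⨆ L, ((Nseq (lastIdx Nseq Xs U L ω) + K : ℕ) : ℝ≥0∞)) = ⊤ := by
        rw [← top_le_iff, ← ENNReal.iSup_natCast]
        refine iSup_mono fun L => ?_
        have h1 := (le_lastIdx_iff le_rfl ω).2 (hall L)
        exact_mod_cast (h1.trans hmono.le_apply).trans (Nat.le_add_right _ _)
      rw [this]; exact le_top
    · push Not at hall
      classical
      obtain ⟨l, hl, hmin⟩ : ∃ l, ω ∉ contEvent Nseq Xs U l ∧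
          ∀ k < l, ω ∈ contEvent Nseq Xs U k :=
        ⟨Nat.find hall, Nat.find_spec hall, fun k hk => not_not.1 (Nat.find_min hall hk)⟩
      obtain ⟨n, rfl⟩ : ∃ n, l = n + 1 :=
        Nat.exists_eq_succ_of_ne_zero fun h0 => hl (h0 ▸ contEvent_zero ω)
      have hn := hmin n (Nat.lt_succ_self n)
      have hnot : sampleMean Xs (Nseq (n + 1)) ω ∉ U (n + 1) := fun hin => hl fun k h1 h2 => by
        rcases Nat.lt_or_ge n k with h3 | h3
        · rwa [show k = n + 1 by omega]
        · exact hn k h1 h3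
      have hgle : g (sampleMean Xs (Nseq (n + 1)) ω) ≤ Nseq (n + 1) := by
        by_contra hlt
        exact hnot ⟨hDE (hω _), (not_le.1 hlt).trans_le (hgh _ (hω _))⟩
      -- Truncation at `n`, the last index of continuation for `h`, suffices: `g` stops by `N_{n+1}
      -- ≤ N_n + K`.
      have h1 : stoppingTime Nseq g Xs ω ≤ ((Nseq (lastIdx Nseq Xs U n ω) + K : ℕ) : ℕ∞) := by
        refine (stoppingTime_le (Nat.le_add_left 1 n) hgle).trans ?_
        have := hmono.monotone ((le_lastIdx_iff le_rfl ω).2 hn)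
        exact_mod_cast (hgap n).trans (Nat.add_le_add_right this K)
      refine le_iSup_of_le n ?_
      have h2 := ENat.toENNReal_le.2 h1
      rwa [ENat.toENNReal_coe] at h2
  refine (lintegral_mono_ae hle).trans ?_
  rw [lintegral_iSup
    (f := fun L ω => ((Nseq (lastIdx Nseq Xs U L ω) + K : ℕ) : ℝ≥0∞))
    (fun L => (measurable_from_nat (f := fun k => ((Nseq k + K : ℕ) : ℝ≥0∞))).comp (hκ L))
    (fun L L' hL ω => by
      have := hmono.monotone (lastIdx_mono (Nseq := Nseq) (Xs := Xs) (U := U) ω hL)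
      exact Nat.cast_le.2 (Nat.add_le_add_right this K))]
  refine iSup_le fun L => ?_
  have hMi : Integrable (fun ω => (Nseq (lastIdx Nseq Xs U L ω) : ℝ)) P :=
    integrable_comp_nat (hκ L) (lastIdx_le L) (Z := fun k _ => (Nseq k : ℝ))
      fun k => integrable_const _
  have h1 : ∫⁻ ω, ((Nseq (lastIdx Nseq Xs U L ω) + K : ℕ) : ℝ≥0∞) ∂P =
      ENNReal.ofReal (∫ ω, ((Nseq (lastIdx Nseq Xs U L ω) : ℝ) + K) ∂P) := by
    rw [ofReal_integral_eq_lintegral_ofReal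
      (f := fun ω => (Nseq (lastIdx Nseq Xs U L ω) : ℝ) + K) (hMi.add (integrable_const _))
      (Filter.Eventually.of_forall fun ω => add_nonneg (Nat.cast_nonneg _) (Nat.cast_nonneg _))]
    refine lintegral_congr fun ω => ?_
    rw [← Nat.cast_add, ENNReal.ofReal_natCast]
  rw [h1, integral_add hMi (integrable_const _), integral_const, probReal_univ, one_smul, add_comm]
  exact ENNReal.ofReal_le_ofReal (add_le_add_right (hbound L) _)

/-! ### Continuous concave majorants by shrinking -/

/-- Shrinking towards an interior point `c` gives a concave majorant of a concave function `g`
that is continuous on the closure of its domain, whereas `g` itself need not be measurable on the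
boundary. -/
noncomputable def shrinkMajorant (g : (Fin d → ℝ) → ℝ) (c : Fin d → ℝ) (s : ℝ)
    (x : Fin d → ℝ) : ℝ :=
  (g ((1 - s) • c + s • x) - (1 - s) * g c) / s

section Shrink

variable {D : Set (Fin d → ℝ)} {g : (Fin d → ℝ) → ℝ} {c : Fin d → ℝ} {s : ℝ}

theorem shrink_mem_interior (hD : Convex ℝ D) (hc : c ∈ interior D) (h0 : 0 < s) (h1 : s < 1)
    {x : Fin d → ℝ} (hx : x ∈ closure D) : (1 - s) • c + s • x ∈ interior D :=
  hD.combo_interior_closure_mem_interior hc hx (by linarith) h0.le (by ring)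

theorem continuousOn_shrinkMajorant (hg : ConcaveOn ℝ D g) (hc : c ∈ interior D)
    (h0 : 0 < s) (h1 : s < 1) : ContinuousOn (shrinkMajorant g c s) (closure D) := by
  refine ContinuousOn.div_const (ContinuousOn.sub ?_ continuousOn_const) _
  exact hg.continuousOn_interior.comp (by fun_prop)
    fun x hx => shrink_mem_interior hg.1 hc h0 h1 hx

theorem concaveOn_shrinkMajorant (hg : ConcaveOn ℝ D g) (hc : c ∈ interior D)
    (h0 : 0 < s) (h1 : s < 1) : ConcaveOn ℝ (closure D) (shrinkMajorant g c s) := by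
  refine ⟨hg.1.closure, fun x hx y hy a b ha hb hab => ?_⟩
  have key := hg.2 (interior_subset (shrink_mem_interior hg.1 hc h0 h1 hx))
    (interior_subset (shrink_mem_interior hg.1 hc h0 h1 hy)) ha hb hab
  have heq : a • ((1 - s) • c + s • x) + b • ((1 - s) • c + s • y) =
      (1 - s) • c + s • (a • x + b • y) := by
    have : b = 1 - a := by linarith
    subst this
    module
  rw [heq] at key
  simp only [shrinkMajorant, smul_eq_mul] at key ⊢
  rw [mul_div_assoc', mul_div_assoc', ← add_div]
  refine div_le_div_of_nonneg_right ?_ h0.le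
  have : (a + b) * ((1 - s) * g c) = (1 - s) * g c := by rw [hab, one_mul]
  linarith

/-- Concavity of `g` on the segment from `c` to `x`, solved for `g x`. -/
theorem le_shrinkMajorant (hg : ConcaveOn ℝ D g) (hc : c ∈ interior D)
    (h0 : 0 < s) (h1 : s < 1) {x : Fin d → ℝ} (hx : x ∈ D) : g x ≤ shrinkMajorant g c s x := by
  have key := hg.2 (interior_subset hc) hx (show 0 ≤ 1 - s by linarith) h0.le (by ring)
  rw [shrinkMajorant, le_div_iff₀ h0]
  simp only [smul_eq_mul] at key
  linarith

end Shrink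

theorem mean_mem_Icc {Ω : Type*} [MeasurableSpace Ω] {P : Measure Ω} [IsProbabilityMeasure P]
    {d : ℕ} {X : Ω → Fin d → ℝ} (hX : Integrable X P) :
    ∫ ω, X ω ∂P ∈ Set.Icc (lowerVec P X) (upperVec P X) := by
  have h1 : ∀ i, (∫ ω, X ω ∂P) i = ∫ ω, X ω i ∂P := eval_integral fun i => hX.eval i
  refine ⟨fun j => ?_, fun j => ?_⟩
  · rw [lowerVec_apply hX, h1]
    exact sub_le_self _ (integral_nonneg fun ω => posPart_nonneg _)
  · rw [upperVec_apply hX, h1]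
    exact le_add_of_nonneg_right (integral_nonneg fun ω => negPart_nonneg _)

/-- A continuous majorant is bounded on the compact part of the closure of `D` in the box; the
factor `1 / 2` is arbitrary. -/
theorem bddAbove_image_feasible {Ω : Type*} [MeasurableSpace Ω] {P : Measure Ω} {d : ℕ}
    {X : Ω → Fin d → ℝ} {D : Set (Fin d → ℝ)} {g : (Fin d → ℝ) → ℝ} (hg : ConcaveOn ℝ D g)
    {c : Fin d → ℝ} (hc : c ∈ interior D) : BddAbove (g '' feasible P X D) := by
  have hK : IsCompact (Set.Icc (lowerVec P X) (upperVec P X) ∩ closure D) :=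
    isCompact_Icc.inter_right isClosed_closure
  have hs0 : (0 : ℝ) < 1 / 2 := by norm_num
  have hs1 : (1 / 2 : ℝ) < 1 := by norm_num
  obtain ⟨B, hB⟩ := hK.bddAbove_image
    ((continuousOn_shrinkMajorant hg hc hs0 hs1).mono Set.inter_subset_right)
  refine ⟨B, ?_⟩
  rintro _ ⟨x, hx, rfl⟩
  exact (le_shrinkMajorant hg hc hs0 hs1 hx.1).trans
    (hB ⟨x, ⟨⟨hx.2.1, hx.2.2⟩, subset_closure hx.1⟩, rfl⟩)

theorem integrable_of_integrable_abs_pow_three {Ω : Type*} [MeasurableSpace Ω] {P : Measure Ω}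
    [IsFiniteMeasure P] {d : ℕ} {X : Ω → Fin d → ℝ} (hX : Measurable X)
    (h : ∀ j, Integrable (fun ω => |X ω j| ^ 3) P) : Integrable X P := by
  refine Integrable.of_eval fun j => ?_
  refine ((integrable_const (1 : ℝ)).add (h j)).mono'
    ((measurable_pi_apply j).comp hX).aestronglyMeasurable
    (Filter.Eventually.of_forall fun ω => ?_)
  have h0 := abs_nonneg (X ω j)
  simp only [Real.norm_eq_abs, Pi.add_apply]
  rcases le_total (|X ω j|) 1 with h1 | h1
  · have := pow_nonneg h0 3
    linarith
  · have := le_self_pow₀ h1 (three_ne_zero)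
    linarith

end SampleMeanStopping

open SampleMeanStopping
theorem theorem12
    {Ω : Type*} [MeasurableSpace Ω] (P : Measure Ω) [IsProbabilityMeasure P]
    (d : ℕ)
    (X : Ω → Fin d → ℝ) (hX : Measurable X)
    (Xs : ℕ → Ω → Fin d → ℝ) (hXs : ∀ i, Measurable (Xs i))
    (hindep : iIndepFun Xs P)
    (hident : ∀ i, IdentDistrib (Xs i) X P P)
    (hmoment : ∀ j : Fin d, Integrable (fun ω => |X ω j| ^ 3) P)
    (Nseq : ℕ → ℕ) (hmono : StrictMono Nseq)
    (K : ℕ) (hKpos : 0 < K) (hN0pos : 0 < Nseq 0)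
    (hgap : ∀ l, Nseq (l + 1) ≤ Nseq l + K) (hKN0 : K ≤ Nseq 0)
    (D : Set (Fin d → ℝ)) (g : (Fin d → ℝ) → ℝ) (hg : ConcaveOn ℝ D g)
    (hμ : (∫ ω, X ω ∂P) ∈ interior D)
    (hrange : ∀ l, ∀ᵐ ω ∂P, SampleMeanStopping.sampleMean Xs (Nseq l) ω ∈ D)
    (hstart : ∀ᵐ ω ∂P,
      (Nseq 0 : ℝ) < g (SampleMeanStopping.sampleMean Xs (Nseq 0) ω)) :
    BddAbove (g '' SampleMeanStopping.feasible P X D) ∧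
    ∫⁻ ω, (SampleMeanStopping.stoppingTime Nseq g Xs ω : ℝ≥0∞) ∂P ≤
      ENNReal.ofReal ((K : ℝ) + sSup (g '' SampleMeanStopping.feasible P X D)) := by
  have hXi := integrable_of_integrable_abs_pow_three hX hmoment
  have hbdd := bddAbove_image_feasible (P := P) (X := X) hg hμ
  refine ⟨hbdd, ?_⟩
  set c := ∫ ω, X ω ∂P with hc
  set G := sSup (g '' SampleMeanStopping.feasible P X D)
  have hbound : ∀ s : ℝ, 0 < s → s < 1 →
      ∫⁻ ω, (stoppingTime Nseq g Xs ω : ℝ≥0∞) ∂P ≤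
        ENNReal.ofReal (K + (G - (1 - s) * g c) / s) := by
    intro s h0 h1
    refine lintegral_stoppingTime_le hXi hXs hindep hident hmono hN0pos hgap hKN0 subset_closure
      isClosed_closure (fun x hx => le_shrinkMajorant hg hμ h0 h1 hx)
      (concaveOn_shrinkMajorant hg hμ h0 h1) (continuousOn_shrinkMajorant hg hμ h0 h1)
      hrange hstart fun θ hθ hθI => ?_
    -- The box contains `μ`, so shrinking towards `μ` keeps `θ` in it and moves it from the closure
    -- into `D`; hence `G` bounds `g` there.
    have hbox := convex_Icc (𝕜 := ℝ) (lowerVec P X) (upperVec P X) (mean_mem_Icc hXi) hθI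
      (by linarith : 0 ≤ 1 - s) h0.le (by ring)
    have hle : g ((1 - s) • c + s • θ) ≤ G :=
      le_csSup hbdd ⟨_, ⟨interior_subset (shrink_mem_interior hg.1 hμ h0 h1 hθ),
        hbox.1, hbox.2⟩, rfl⟩
    exact div_le_div_of_nonneg_right (by linarith) h0.le
  -- As `s → 1` the term with `g c` vanishes and the bound tends to `K + G`.
  have hlim : Filter.Tendsto (fun s : ℝ => ENNReal.ofReal (K + (G - (1 - s) * g c) / s))
      (nhdsWithin 1 (Set.Iio 1)) (nhds (ENNReal.ofReal (K + G))) := by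
    refine (ENNReal.continuous_ofReal.tendsto _).comp
      (Filter.Tendsto.mono_left ?_ nhdsWithin_le_nhds)
    have : ContinuousAt (fun s : ℝ => (K : ℝ) + (G - (1 - s) * g c) / s) 1 := by
      fun_prop (disch := norm_num)
    simpa [ContinuousAt] using this
  refine ge_of_tendsto hlim ?_
  filter_upwards [Ioo_mem_nhdsLT (zero_lt_one' ℝ)] with s hs using hbound s hs.1 hs.2
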